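/- Let $n_A,n_B\ge 0$ be integers, $\mathcal H_A=(\mathbb C^2)^{\otimes n_A}$ and $\mathcal H_B=(\mathbb C^2)^{\otimes n_B}$, let $\mathcal X,\mathcal Y$ be finite sets, and let $\{U_{x,y}\}_{x\in\mathcal X,\,y\in\mathcal Y}$ be a family of unitaries on $\mathcal H_A\otimes\mathcal H_B$. An EPR pair is the two-qubit state $(|00\rangle+|11\rangle)/\sqrt2$. For every $\varepsilon>0$ there is $N_0$ such that for every $N\ge N_0$, when Alice and Bob share $N$ EPR pairs, there exist * finite sets $K$, $L$ of classical outputs; * for every $x\in\mathcal X$ a local operation $\mathcal A_x$ of Alice, i.e. a quantum measurement with outcomes $k\in K$ on $\mathcal H_A$ and her $N$ EPR halves, given by operators $A_{x,k}:\mathcal H_A\otimes(\mathbb C^2)^{\otimes N}\to\mathcal H_A$ with $\sum_{k} A_{x,k}^\dagger A_{x,k}=\mathbb I$; * for every $y\in\mathcal Y$ a local operation $\mathcal B_y$ of Bob, given likewise by operators $B_{y,\ell}:\mathcal H_B\otimes(\mathbb C^2)^{\otimes N}\to\mathcal H_B$, $\ell\in L$, with $\sum_{\ell} B_{y,\ell}^\dagger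 B_{y,\ell}=\mathbb I$; * families $\{V^A_{k,\ell}\}$ and $\{V^B_{k,\ell}\}$ of unitaries on $\mathcal H_A$ and $\mathcal H_B$, indexed by $K\times L$ and depending on nothing else, each of which is, up to a global phase, a tensor product of one-qubit Pauli operators from $\{\mathbb I,X,Z,XZ\}$, with the following property. For every Hilbert space $\mathcal H_E$, every unit vector $|\psi\rangle\in\mathcal H_A\otimes\mathcal H_B\otimes\mathcal H_E$ and all $x\in\mathcal X$, $y\in\mathcal Y$, the joint execution of $\mathcal A_x\otimes\mathcal B_y$, without any communication, on $|\psi\rangle$ and the $N$ EPR pairs yields random outputs $k$ for Alice and $\ell$ for Bob and a resulting normalized state $|\varphi'\rangle\in\mathcal H_A\otimes\mathcal H_B\otimes\mathcal H_E$ such that, except with probability at most $\varepsilon$, $$(U_{x,y}\otimes\mathbb I)|\psi\rangle=(V^A_{k,\ell}\otimes V^B_{k,\ell}\otimes\mathbb I)|\varphi'\rangle .$$ -/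

import Mathlib

namespace NonlocalComputation

open scoped Kronecker Matrix

noncomputable section

/-- Labels of the computational basis of `n` qubits, so that the state space of an `n`-qubit system,
`(ℂ²)^{⊗ n}`, has coordinates indexed by `Reg n`, and that of two systems by `Reg n × Reg m`. -/
abbrev Reg (n : ℕ) : Type := Fin n → Fin 2

/-- The Hilbert space `ℂ^ι ⊗ H`: a vector `∑ i, |i⟩ ⊗ v i` is the family of its components `v i ∈ H`,
with squared norm `∑ i, ‖v i‖ ^ 2`. -/
abbrev Joint (ι : Type*) (H : Type*) : Type _ := PiLp 2 (fun _ : ι => H)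

/-- The operator `M ⊗ 𝕀 : ℂ^ι ⊗ H → ℂ^κ ⊗ H`. -/
def applyOp {ι κ : Type*} [Fintype ι] {H : Type*} [NormedAddCommGroup H] [InnerProductSpace ℂ H]
    (M : Matrix κ ι ℂ) (v : Joint ι H) : Joint κ H :=
  WithLp.toLp 2 fun i => ∑ j, M i j • v j

/-- Amplitudes of the EPR pair `(|00⟩ + |11⟩) / √2`. -/
def epr (s t : Fin 2) : ℂ := if s = t then ((Real.sqrt 2 : ℝ) : ℂ)⁻¹ else 0

/-- The state `|ψ⟩_{ABE}` together with `N` EPR pairs shared by Alice and Bob. The systems of Alice are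
labelled by `Reg nA × Reg N` (her part `A` and her halves of the pairs), those of Bob by
`Reg nB × Reg N`. -/
def withEPR {nA nB : ℕ} (N : ℕ) {H : Type*} [NormedAddCommGroup H] [InnerProductSpace ℂ H]
    (ψ : Joint (Reg nA × Reg nB) H) : Joint ((Reg nA × Reg N) × (Reg nB × Reg N)) H :=
  WithLp.toLp 2 fun p => (∏ j, epr (p.1.2 j) (p.2.2 j)) • ψ (p.1.1, p.2.1)

/-- A local operation of one party, holding `n` qubits and its halves of `N` EPR pairs, which outputs
`n` qubits and a classical value in `K`: a general quantum measurement given by its measurement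
(Kraus) operators `(ℂ²)^{⊗ n} ⊗ (ℂ²)^{⊗ N} → (ℂ²)^{⊗ n}`, one for every classical value. -/
structure LocalOp (n N : ℕ) (K : Type*) [Fintype K] where
  kraus : K → Matrix (Reg n) (Reg n × Reg N) ℂ
  complete : ∑ k, (kraus k)ᴴ * kraus k = 1

section Execution

variable {nA nB N : ℕ} {K L : Type*} [Fintype K] [Fintype L]
  {H : Type*} [NormedAddCommGroup H] [InnerProductSpace ℂ H]

/-- The unnormalised state of `ABE` after the joint execution of `𝒜 ⊗ ℬ` on `ψ` and the EPR pairs,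
for the classical outputs `k` and `l`. -/
def rawOutput (𝒜 : LocalOp nA N K) (ℬ : LocalOp nB N L) (ψ : Joint (Reg nA × Reg nB) H)
    (k : K) (l : L) : Joint (Reg nA × Reg nB) H :=
  applyOp (𝒜.kraus k ⊗ₖ ℬ.kraus l) (withEPR N ψ)

/-- The probability of the classical outputs `k` and `l`. -/
def outputProb (𝒜 : LocalOp nA N K) (ℬ : LocalOp nB N L) (ψ : Joint (Reg nA × Reg nB) H)
    (k : K) (l : L) : ℝ :=
  ‖rawOutput 𝒜 ℬ ψ k l‖ ^ 2

/-- The state `|φ'⟩` of `ABE` after the joint execution, given that the classical outputs are `k` and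
`l` (meaningful when these have positive probability). -/
def outputState (𝒜 : LocalOp nA N K) (ℬ : LocalOp nB N L) (ψ : Joint (Reg nA × Reg nB) H)
    (k : K) (l : L) : Joint (Reg nA × Reg nB) H :=
  ((‖rawOutput 𝒜 ℬ ψ k l‖⁻¹ : ℝ) : ℂ) • rawOutput 𝒜 ℬ ψ k l

open Classical in
/-- The probability that the classical outputs `k`, `l` and the state `|φ'⟩` do not satisfy
`(U ⊗ 𝕀)|ψ⟩ = (VA k l ⊗ VB k l ⊗ 𝕀)|φ'⟩`. -/
def failureProb (𝒜 : LocalOp nA N K) (ℬ : LocalOp nB N L)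
    (VA : K → L → Matrix (Reg nA) (Reg nA) ℂ) (VB : K → L → Matrix (Reg nB) (Reg nB) ℂ)
    (U : Matrix (Reg nA × Reg nB) (Reg nA × Reg nB) ℂ) (ψ : Joint (Reg nA × Reg nB) H) : ℝ :=
  ∑ k, ∑ l,
    if applyOp U ψ = applyOp (VA k l ⊗ₖ VB k l) (outputState 𝒜 ℬ ψ k l) then 0
    else outputProb 𝒜 ℬ ψ k l

end Execution

/-- The one-qubit operators `𝕀, X, Z, XZ`. -/
def pauli : Fin 4 → Matrix (Fin 2) (Fin 2) ℂ :=
  ![1, !![0, 1; 1, 0], !![1, 0; 0, -1], !![0, 1; 1, 0] * !![1, 0; 0, -1]]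

/-- The qubit-wise operator `M 0 ⊗ ⋯ ⊗ M (n - 1)` on `n` qubits. -/
def qubitwise {n : ℕ} (M : Fin n → Matrix (Fin 2) (Fin 2) ℂ) : Matrix (Reg n) (Reg n) ℂ :=
  Matrix.of fun a b => ∏ i, M i (a i) (b i)

/-- `V` is a tensor product of one-qubit Pauli operators, up to a global phase. -/
def IsPauliProduct {n : ℕ} (V : Matrix (Reg n) (Reg n) ℂ) : Prop :=
  ∃ (c : ℂ) (s : Fin n → Fin 4), ‖c‖ = 1 ∧ V = c • qubitwise fun i => pauli (s i)

end

end NonlocalComputation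

/-!
# Instantaneous nonlocal computation up to Pauli corrections

Bob teleports his part of the state to Alice, who then holds the whole state up to a Pauli
operator known to Bob only. It remains to treat the case in which Alice holds the state and knows
`x`, and Bob knows `y` and holds nothing but halves of EPR pairs (`Scheme`); at the end Alice
teleports Bob's part back (`aliceOp`, `bobOp`, `jointOp_aliceOp_bobOp`).

In one round (`Scheme.step`), Bob takes for every possible input `x'` of Alice a bunch of EPR
pairs and measures his halves in the basis of the vectorised unitaries `P_b U_{x',y}`, where the
`P_b` are the Pauli products; Alice's halves are then the Choi states of these unitaries. Alice
teleports the state through the bunch of her actual input `x` (`transfer_teleportKraus`), so that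
it undergoes `P_b U_{x,y} P_a` with `a` known to her and `b` to Bob. With probability `1 / d ^ 2`,
where `d` is the dimension, `P_a` is the identity; then Alice stops, and only the Pauli operator
`P_b` has to be undone. Otherwise the unitary `U_{x,y} (P_b U_{x,y} P_a)⁻¹` remains to be applied.
It is determined by the pairs `(x, a)` and `(y, b)`, the first known to Alice and the second to
Bob, so that the same problem has to be solved for a larger finite set of inputs. After `t` rounds
the probability of failure is `(1 - 1 / d ^ 2) ^ t` (`exists_scheme`).

Every successful pair of outputs acts as a scalar multiple of a Pauli operator times `U_{x,y}`.
The moduli of these scalars give the success probability (`failureProb_le`). Their phases depend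
on both inputs; the classical outputs include the inputs, so that the phases can be undone by the
corrections (`correctionA`).
-/

open scoped Kronecker Matrix

namespace NonlocalComputation

/-! ### Kraus operators acting on vectors with an environment -/

section Kraus

variable {ι κ μ K : Type*} {H : Type*} [NormedAddCommGroup H] [InnerProductSpace ℂ H]

theorem sum_conjTranspose_mul_eq_one_iff [Fintype κ] [Fintype K] [DecidableEq ι]
    (A : K → Matrix κ ι ℂ) :
    ∑ k, (A k)ᴴ * A k = 1 ↔
      ∀ i j, ∑ k, ∑ o, star (A k o i) * A k o j = if i = j then 1 else 0 := by
  rw [← Matrix.ext_iff]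
  simp only [Matrix.sum_apply, Matrix.mul_apply, Matrix.conjTranspose_apply, Matrix.one_apply]

theorem applyOp_mul [Fintype ι] [Fintype κ] (M : Matrix μ κ ℂ) (M' : Matrix κ ι ℂ)
    (v : Joint ι H) :
    applyOp (M * M') v = applyOp M (applyOp M' v) := by
  ext i
  simp only [applyOp, Matrix.mul_apply, Finset.sum_smul, Finset.smul_sum, smul_smul]
  exact Finset.sum_comm

theorem applyOp_smul_left [Fintype ι] (c : ℂ) (M : Matrix κ ι ℂ) (v : Joint ι H) :
    applyOp (c • M) v = c • applyOp M v := by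
  ext i
  simp [applyOp, Finset.smul_sum, smul_smul]

theorem applyOp_smul_right [Fintype ι] (c : ℂ) (M : Matrix κ ι ℂ) (v : Joint ι H) :
    applyOp M (c • v) = c • applyOp M v := by
  ext i
  simp [applyOp, Finset.smul_sum, smul_smul, mul_comm]

theorem Joint.norm_sq_eq_sum_inner [Fintype ι] (v : Joint ι H) :
    ((‖v‖ ^ 2 : ℝ) : ℂ) = ∑ i, inner ℂ (v i) (v i) := by
  rw [← PiLp.inner_apply, inner_self_eq_norm_sq_to_K]
  simp

theorem sum_norm_applyOp_sq [Fintype ι] [Fintype κ] [Fintype K] [DecidableEq ι]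
    (A : K → Matrix κ ι ℂ) (hA : ∑ k, (A k)ᴴ * A k = 1) (v : Joint ι H) :
    ∑ k, ‖applyOp (A k) v‖ ^ 2 = ‖v‖ ^ 2 := by
  rw [sum_conjTranspose_mul_eq_one_iff] at hA
  suffices h : ((∑ k, ‖applyOp (A k) v‖ ^ 2 : ℝ) : ℂ) = ((‖v‖ ^ 2 : ℝ) : ℂ) by exact_mod_cast h
  have key : ∀ k, ((‖applyOp (A k) v‖ ^ 2 : ℝ) : ℂ)
      = ∑ i, ∑ j, (∑ o, star (A k o i) * A k o j) * inner ℂ (v i) (v j) := by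
    intro k
    rw [Joint.norm_sq_eq_sum_inner]
    simp only [applyOp, sum_inner, inner_sum, inner_smul_left, inner_smul_right, Finset.sum_mul,
      Finset.mul_sum]
    rw [Finset.sum_comm]
    conv_rhs => rw [Finset.sum_comm]
    refine Finset.sum_congr rfl fun i _ => ?_
    rw [Finset.sum_comm]
    refine Finset.sum_congr rfl fun j _ => Finset.sum_congr rfl fun o _ => ?_
    simp only [RCLike.star_def]
    ring
  rw [Complex.ofReal_sum, Finset.sum_congr rfl fun k _ => key k, Finset.sum_comm,
    Joint.norm_sq_eq_sum_inner]
  refine Finset.sum_congr rfl fun i _ => ?_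
  rw [Finset.sum_comm]
  simp only [← Finset.sum_mul, hA, ite_mul, one_mul, zero_mul, Finset.sum_ite_eq,
    Finset.mem_univ, if_true]

theorem norm_applyOp_unitary [Fintype ι] [DecidableEq ι] (W : Matrix.unitaryGroup ι ℂ)
    (v : Joint ι H) :
    ‖applyOp (W : Matrix ι ι ℂ) v‖ = ‖v‖ := by
  have h := sum_norm_applyOp_sq (fun _ : Unit => (W : Matrix ι ι ℂ))
    (by rw [Fintype.sum_unique]; exact Matrix.UnitaryGroup.star_mul_self W) v
  simpa using h

end Kraus

/-! ### Unitary error bases -/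

/-- A unitary error basis on `ℂ^D` that contains the identity: a family of unitaries which, after
division by `√|D|`, is an orthonormal basis of the matrices. Orthonormality is recorded in its dual
form, as the completeness of the family on `ℂ^D ⊗ ℂ^D`. -/
structure ErrorBasis (D Λ : Type) [Fintype D] [DecidableEq D] [Fintype Λ] where
  op : Λ → Matrix.unitaryGroup D ℂ
  unit : Λ
  op_unit : op unit = 1
  complete : ∀ i j i' j', ∑ a, star (op a i j) * op a i' j' =
    if i = i' ∧ j = j' then (Fintype.card D : ℂ) else 0
  card_eq : Fintype.card Λ = Fintype.card D ^ 2

section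

variable {D E Λ Λ' : Type} [Fintype D] [DecidableEq D] [Fintype Λ]
  [Fintype E] [DecidableEq E] [Fintype Λ']

/-- The tensor product of two unitaries. -/
def kronUnitary (V : Matrix.unitaryGroup D ℂ) (W : Matrix.unitaryGroup E ℂ) :
    Matrix.unitaryGroup (D × E) ℂ :=
  ⟨(V : Matrix D D ℂ) ⊗ₖ (W : Matrix E E ℂ), Matrix.kronecker_mem_unitary V.2 W.2⟩

/-- The tensor product of two unitary error bases. -/
def ErrorBasis.prod (B : ErrorBasis D Λ) (C : ErrorBasis E Λ') : ErrorBasis (D × E) (Λ × Λ') where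
  op a := kronUnitary (B.op a.1) (C.op a.2)
  unit := (B.unit, C.unit)
  op_unit := by
    apply Subtype.ext
    simp [kronUnitary, B.op_unit, C.op_unit]
  complete := by
    rintro ⟨i, p⟩ ⟨j, q⟩ ⟨i', p'⟩ ⟨j', q'⟩
    have h : ∀ a : Λ × Λ', star ((kronUnitary (B.op a.1) (C.op a.2) : Matrix _ _ ℂ) (i, p) (j, q)) *
        (kronUnitary (B.op a.1) (C.op a.2) : Matrix _ _ ℂ) (i', p') (j', q') =
        (star (B.op a.1 i j) * B.op a.1 i' j') * (star (C.op a.2 p q) * C.op a.2 p' q') := by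
      intro a
      simp only [kronUnitary, Matrix.kroneckerMap_apply, star_mul']
      ring
    refine (Finset.sum_congr rfl fun a _ => h a).trans ?_
    rw [Fintype.sum_prod_type]
    simp only [← Finset.mul_sum, ← Finset.sum_mul, B.complete, C.complete, Prod.mk.injEq,
      Fintype.card_prod]
    by_cases h1 : i = i' <;> by_cases h2 : p = p' <;> by_cases h3 : j = j' <;>
      by_cases h4 : q = q' <;> simp [*]
  card_eq := by
    simp [B.card_eq, C.card_eq, mul_pow]

theorem sum_norm_sq_unitary (W : Matrix.unitaryGroup D ℂ) :
    ∑ p : D × D, ‖W p.2 p.1‖ ^ 2 = (Fintype.card D : ℝ) := by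
  have h : ∀ s, ∑ t, ‖W t s‖ ^ 2 = (1 : ℝ) := by
    intro s
    have := congrFun (congrFun (Matrix.UnitaryGroup.star_mul_self W) s) s
    simp only [Matrix.mul_apply, Matrix.star_apply, Matrix.one_apply_eq] at this
    have h2 : ((∑ t, ‖W t s‖ ^ 2 : ℝ) : ℂ) = 1 := by
      rw [← this]
      push_cast
      refine Finset.sum_congr rfl fun t _ => ?_
      exact (RCLike.conj_mul _).symm
    exact_mod_cast h2
  simp [Fintype.sum_prod_type, h]

end

/-! ### Pauli products -/

section Pauli

variable {n : ℕ}

theorem qubitwise_mul (M M' : Fin n → Matrix (Fin 2) (Fin 2) ℂ) :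
    qubitwise M * qubitwise M' = qubitwise fun i => M i * M' i := by
  ext a b
  simp only [qubitwise, Matrix.mul_apply, Matrix.of_apply, ← Finset.prod_mul_distrib]
  rw [Finset.prod_univ_sum, Fintype.piFinset_univ]

theorem qubitwise_conjTranspose (M : Fin n → Matrix (Fin 2) (Fin 2) ℂ) :
    (qubitwise M)ᴴ = qubitwise fun i => (M i)ᴴ := by
  ext a b
  simp [qubitwise, Matrix.conjTranspose_apply]

theorem qubitwise_one : (qubitwise fun _ : Fin n => 1) = 1 := by
  ext a b
  by_cases h : a = b
  · subst h
    simp [qubitwise]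
  · obtain ⟨i, hi⟩ := Function.ne_iff.1 h
    rw [Matrix.one_apply_ne h]
    exact Finset.prod_eq_zero (Finset.mem_univ i) (by simp [hi])

theorem qubitwise_smul (c : Fin n → ℂ) (M : Fin n → Matrix (Fin 2) (Fin 2) ℂ) :
    (qubitwise fun i => c i • M i) = (∏ i, c i) • qubitwise M := by
  ext a b
  simp [qubitwise, Finset.prod_mul_distrib]

theorem pauli_conjTranspose_mul_self (s : Fin 4) : (pauli s)ᴴ * pauli s = 1 := by
  fin_cases s <;> ext i j <;> fin_cases i <;> fin_cases j <;>
    simp [pauli, Matrix.mul_apply, Fin.sum_univ_two]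

theorem exists_pauli_conjTranspose (s : Fin 4) :
    ∃ (c : ℂ) (r : Fin 4), ‖c‖ = 1 ∧ (pauli s)ᴴ = c • pauli r := by
  fin_cases s
  · exact ⟨1, 0, by simp, by simp [pauli]⟩
  · exact ⟨1, 1, by simp, by ext i j; fin_cases i <;> fin_cases j <;> simp [pauli]⟩
  · exact ⟨1, 2, by simp, by ext i j; fin_cases i <;> fin_cases j <;> simp [pauli]⟩
  · exact ⟨-1, 3, by simp, by ext i j; fin_cases i <;> fin_cases j <;> simp [pauli]⟩

theorem exists_pauli_mul (s t : Fin 4) :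
    ∃ (c : ℂ) (r : Fin 4), ‖c‖ = 1 ∧ pauli s * pauli t = c • pauli r := by
  -- Each product is `± pauli r`; the binary digits of `r` are those of `s` and `t`
  -- added modulo 2.
  fin_cases s <;> fin_cases t
  · exact ⟨1, 0, by simp, by simp [pauli]⟩
  · exact ⟨1, 1, by simp, by simp [pauli]⟩
  · exact ⟨1, 2, by simp, by simp [pauli]⟩
  · exact ⟨1, 3, by simp, by simp [pauli]⟩
  · exact ⟨1, 1, by simp, by simp [pauli]⟩
  · exact ⟨1, 0, by simp, by simp [pauli, Matrix.one_fin_two]⟩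
  · exact ⟨1, 3, by simp, by simp [pauli]⟩
  · exact ⟨1, 2, by simp, by simp [pauli]⟩
  · exact ⟨1, 2, by simp, by simp [pauli]⟩
  · exact ⟨-1, 3, by simp, by simp [pauli]⟩
  · exact ⟨1, 0, by simp, by simp [pauli, Matrix.one_fin_two]⟩
  · exact ⟨-1, 1, by simp, by simp [pauli]⟩
  · exact ⟨1, 3, by simp, by simp [pauli]⟩
  · exact ⟨-1, 2, by simp, by simp [pauli]⟩
  · exact ⟨1, 1, by simp, by simp [pauli]⟩
  · exact ⟨-1, 0, by simp, by simp [pauli, Matrix.one_fin_two]⟩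

theorem sum_star_pauli_mul_pauli (i j i' j' : Fin 2) :
    ∑ s, star (pauli s i j) * pauli s i' j' = if i = i' ∧ j = j' then 2 else 0 := by
  have h0 : pauli 0 = 1 := rfl
  have h1 : pauli 1 = !![0, 1; 1, 0] := rfl
  have h2 : pauli 2 = !![1, 0; 0, -1] := rfl
  have h3 : pauli 3 = !![0, -1; 1, 0] := by simp [pauli]
  rw [Fin.sum_univ_four, h0, h1, h2, h3]
  fin_cases i <;> fin_cases j <;> fin_cases i' <;> fin_cases j' <;> norm_num

theorem IsPauliProduct.mul {V W : Matrix (Reg n) (Reg n) ℂ} (hV : IsPauliProduct V)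
    (hW : IsPauliProduct W) : IsPauliProduct (V * W) := by
  obtain ⟨c, s, hc, rfl⟩ := hV
  obtain ⟨d, t, hd, rfl⟩ := hW
  choose e r he hr using fun i => exists_pauli_mul (s i) (t i)
  refine ⟨c * d * ∏ i, e i, r, by simp [hc, hd, he], ?_⟩
  simp only [Matrix.smul_mul, Matrix.mul_smul, qubitwise_mul, hr, qubitwise_smul, smul_smul]
  congr 1
  ring

theorem IsPauliProduct.conjTranspose {V : Matrix (Reg n) (Reg n) ℂ} (hV : IsPauliProduct V) :
    IsPauliProduct Vᴴ := by
  obtain ⟨c, s, hc, rfl⟩ := hV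
  choose e r he hr using fun i => exists_pauli_conjTranspose (s i)
  refine ⟨star c * ∏ i, e i, r, by simp [hc, he], ?_⟩
  simp only [Matrix.conjTranspose_smul, qubitwise_conjTranspose, hr, qubitwise_smul, smul_smul]

theorem IsPauliProduct.smul {V : Matrix (Reg n) (Reg n) ℂ} (hV : IsPauliProduct V) {c : ℂ}
    (hc : ‖c‖ = 1) : IsPauliProduct (c • V) := by
  obtain ⟨d, s, hd, rfl⟩ := hV
  exact ⟨c * d, s, by simp [hc, hd], by rw [smul_smul]⟩

/-- The products of the operators `𝕀, X, Z, XZ` form a unitary error basis on `n` qubits. -/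
noncomputable def pauliBasis (n : ℕ) : ErrorBasis (Reg n) (Fin n → Fin 4) where
  op s := ⟨qubitwise fun i => pauli (s i), by
    rw [Matrix.mem_unitaryGroup_iff']
    change (qubitwise _)ᴴ * _ = 1
    simp only [qubitwise_conjTranspose, qubitwise_mul, pauli_conjTranspose_mul_self, qubitwise_one]⟩
  unit := 0
  op_unit := Subtype.ext (by simpa [pauli] using qubitwise_one)
  complete a b a' b' := by
    have h : ∀ s : Fin n → Fin 4, star (qubitwise (fun i => pauli (s i)) a b) *
        qubitwise (fun i => pauli (s i)) a' b' =
        ∏ i, star (pauli (s i) (a i) (b i)) * pauli (s i) (a' i) (b' i) := by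
      intro s
      simp [qubitwise, Finset.prod_mul_distrib]
    refine (Finset.sum_congr rfl fun s _ => h s).trans ?_
    rw [← Fintype.piFinset_univ, ← Finset.prod_univ_sum (fun _ => Finset.univ)
      (fun i s => star (pauli s (a i) (b i)) * pauli s (a' i) (b' i))]
    simp only [sum_star_pauli_mul_pauli]
    split_ifs with hab
    · simp [hab]
    · have : ∃ i, ¬ (a i = a' i ∧ b i = b' i) := by
        by_contra! hh
        exact hab ⟨funext fun i => (hh i).1, funext fun i => (hh i).2⟩
      obtain ⟨i, hi⟩ := this
      exact Finset.prod_eq_zero (Finset.mem_univ i) (if_neg hi)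
  card_eq := by
    simp only [Fintype.card_fun, Fintype.card_fin]
    rw [← pow_mul, mul_comm, pow_mul]
    norm_num

theorem isPauliProduct_pauliBasis (s : Fin n → Fin 4) :
    IsPauliProduct ((pauliBasis n).op s : Matrix (Reg n) (Reg n) ℂ) :=
  ⟨1, s, by simp, by rw [one_smul]; rfl⟩

end Pauli

/-! ### Schemes in which the state is held by one party -/

section Transfer

variable {D R : Type} [DecidableEq D] [Fintype R] [DecidableEq R]

/-- The operator `ℂ^D → ℂ^D` that results, up to the normalisation `|R|^{-1/2}`, from measuring the
two halves of `∑ r, |r r⟩`: the first together with `ℂ^D`, with result `A`, and the second with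
result `⟨β|`. -/
def transfer {D R : Type} [Fintype R] (A : Matrix D (D × R) ℂ) (β : R → ℂ) : Matrix D D ℂ :=
  Matrix.of fun o i => ∑ r, A o (i, r) * β r

theorem computationalKraus_complete [Fintype D] (i j : D × R) :
    ∑ r, ∑ o, star (if i = (o, r) then (1 : ℂ) else 0) * (if j = (o, r) then 1 else 0) =
      if i = j then 1 else 0 := by
  rw [Finset.sum_comm, ← Fintype.sum_prod_type' (fun o r =>
      star (if i = (o, r) then (1 : ℂ) else 0) * (if j = (o, r) then 1 else 0))]
  simp

theorem transfer_computationalKraus (r : R) (β : R → ℂ) :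
    transfer (Matrix.of fun (o : D) p => if p = (o, r) then 1 else 0) β = β r • 1 := by
  ext o i
  simp only [transfer, Matrix.of_apply, Prod.mk.injEq, Matrix.smul_apply, Matrix.one_apply]
  by_cases h : i = o
  · simp [h]
  · simp [h, Ne.symm h]

end Transfer

section Scheme

variable {D Λ R R' : Type} [Fintype D] [DecidableEq D] [Fintype Λ] [Fintype R] [DecidableEq R]
  [Fintype R'] [DecidableEq R'] {X : Type} {Y : Type}

/-- A scheme for the family `U` in which Alice holds the whole state in `ℂ^D`, and the two parties
share the maximally entangled state on `ℂ^R ⊗ ℂ^R`. Bob measures his half with rank-one operators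
`⟨bob y l|`; Alice's Kraus operators `alice x k` act on the state and on her half. For results
with `amp x y k l ≠ 0` the state undergoes `U x y` followed by the operator of the error basis
with index `label x y k l`; the total probability of the other results is `δ`. Neither party need
know the label or the amplitude, which may depend on the inputs and results of both. -/
structure Scheme (B : ErrorBasis D Λ) (R : Type) [Fintype R] [DecidableEq R]
    (U : X → Y → Matrix.unitaryGroup D ℂ) (δ : ℝ) where
  K : Type
  L : Type
  [fintypeK : Fintype K]
  [fintypeL : Fintype L]
  alice : X → K → Matrix D (D × R) ℂ
  bob : Y → L → R → ℂ
  alice_complete : ∀ x i j, ∑ k, ∑ o, star (alice x k o i) * alice x k o j = if i = j then 1 else 0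
  bob_complete : ∀ y r s, ∑ l, star (bob y l r) * bob y l s = if r = s then 1 else 0
  label : X → Y → K → L → Λ
  amp : X → Y → K → L → ℂ
  implements : ∀ x y k l, amp x y k l ≠ 0 → transfer (alice x k) (bob y l) =
    amp x y k l • ((B.op (label x y k l) : Matrix D D ℂ) * (U x y : Matrix D D ℂ))
  weight : ∀ x y, ∑ k, ∑ l, ‖amp x y k l‖ ^ 2 = (1 - δ) * Fintype.card R

attribute [instance] Scheme.fintypeK Scheme.fintypeL

variable {B : ErrorBasis D Λ} {U : X → Y → Matrix.unitaryGroup D ℂ} {δ : ℝ}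

/-- The scheme that measures the entangled state in the computational basis and never succeeds. -/
def Scheme.trivial (B : ErrorBasis D Λ) (R : Type) [Fintype R] [DecidableEq R]
    (U : X → Y → Matrix.unitaryGroup D ℂ) : Scheme B R U 1 where
  K := R
  L := R
  alice _ k := Matrix.of fun o p => if p = (o, k) then 1 else 0
  bob _ l r := if r = l then 1 else 0
  alice_complete _ := computationalKraus_complete
  bob_complete := by
    intro _ r s
    simp
  label _ _ _ _ := B.unit
  amp _ _ _ _ := 0
  implements := by simp
  weight := by simp

/-- Restriction of a scheme along a map of Alice's inputs. -/
def Scheme.comap {X' : Type} (S : Scheme B R U δ) (f : X' → X) :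
    Scheme B R (fun x y => U (f x) y) δ where
  K := S.K
  L := S.L
  alice x := S.alice (f x)
  bob := S.bob
  alice_complete x := S.alice_complete (f x)
  bob_complete := S.bob_complete
  label x := S.label (f x)
  amp x := S.amp (f x)
  implements x := S.implements (f x)
  weight x := S.weight (f x)

/-- Relabelling of the basis of the shared entangled state. -/
def Scheme.reindex (S : Scheme B R U δ) (e : R ≃ R') : Scheme B R' U δ where
  K := S.K
  L := S.L
  alice x k := Matrix.of fun o p => S.alice x k o (p.1, e.symm p.2)
  bob y l r := S.bob y l (e.symm r)
  alice_complete x i j := by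
    exact (S.alice_complete x _ _).trans (by simp [Prod.ext_iff])
  bob_complete y r s := by
    exact (S.bob_complete y _ _).trans (by simp)
  label := S.label
  amp := S.amp
  implements x y k l h := by
    rw [← S.implements x y k l h]
    ext o i
    exact e.symm.sum_comp fun r => S.alice x k o (i, r) * S.bob y l r
  weight x y := by rw [S.weight, Fintype.card_congr e]

end Scheme

/-! ### Gate teleportation -/

section EntNorm

variable {D : Type} [Fintype D]

/-- The normalisation `|D|^{-1/2}` of a maximally entangled vector in `ℂ^D ⊗ ℂ^D`. -/
noncomputable def entNorm (D : Type) [Fintype D] : ℂ := ((Real.sqrt (Fintype.card D))⁻¹ : ℝ)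

theorem star_entNorm : star (entNorm D) = entNorm D := Complex.conj_ofReal _

theorem entNorm_mul_self_mul_card [Nonempty D] :
    entNorm D * entNorm D * (Fintype.card D : ℂ) = 1 := by
  have h : Real.sqrt (Fintype.card D) * Real.sqrt (Fintype.card D) = Fintype.card D :=
    Real.mul_self_sqrt (Nat.cast_nonneg _)
  have h0 : (Fintype.card D : ℝ) ≠ 0 := Nat.cast_ne_zero.2 Fintype.card_ne_zero
  have : (Real.sqrt (Fintype.card D))⁻¹ * (Real.sqrt (Fintype.card D))⁻¹ * (Fintype.card D : ℝ)
      = 1 := by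
    rw [← mul_inv, h, inv_mul_cancel₀ h0]
  unfold entNorm
  exact_mod_cast this

theorem norm_entNorm_sq : ‖entNorm D‖ ^ 2 = (Fintype.card D : ℝ)⁻¹ := by
  unfold entNorm
  rw [Complex.norm_real, Real.norm_eq_abs, sq_abs, inv_pow, Real.sq_sqrt (Nat.cast_nonneg _)]

end EntNorm

section Teleport

variable {D Λ R K : Type} [Fintype D] [DecidableEq D] [Fintype Λ] {m : ℕ}

theorem ErrorBasis.sum_star_mul [Nonempty D] (B : ErrorBasis D Λ) (i j i' j' : D) :
    ∑ a, star (entNorm D * B.op a i j) * (entNorm D * B.op a i' j') =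
      if i = i' ∧ j = j' then 1 else 0 := by
  have h : ∀ a, star (entNorm D * B.op a i j) * (entNorm D * B.op a i' j') =
      entNorm D * entNorm D * (star (B.op a i j) * B.op a i' j') := by
    intro a
    rw [star_mul', star_entNorm]
    ring
  simp_rw [h]
  rw [← Finset.mul_sum, B.complete]
  split_ifs
  · exact entNorm_mul_self_mul_card
  · simp

theorem ErrorBasis.sum_star_mul_unitary [Nonempty D] (B : ErrorBasis D Λ)
    (W : Matrix.unitaryGroup D ℂ) (i j i' j' : D) :
    ∑ a, star (entNorm D * (B.op a * W : Matrix.unitaryGroup D ℂ) i j) *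
      (entNorm D * (B.op a * W : Matrix.unitaryGroup D ℂ) i' j') =
      if i = i' ∧ j = j' then 1 else 0 := by
  have hW := congrFun (congrFun (Matrix.UnitaryGroup.star_mul_self W) j) j'
  simp only [Matrix.mul_apply, Matrix.star_apply, Matrix.one_apply] at hW
  have h : ∀ a, star (entNorm D * (B.op a * W : Matrix.unitaryGroup D ℂ) i j) *
      (entNorm D * (B.op a * W : Matrix.unitaryGroup D ℂ) i' j') =
      ∑ u, ∑ u', (star (entNorm D * B.op a i u) * (entNorm D * B.op a i' u')) *
        (star (W u j) * W u' j') := by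
    intro a
    rw [Matrix.UnitaryGroup.mul_apply, Matrix.mul_apply, Matrix.mul_apply, Finset.mul_sum,
      Finset.mul_sum, star_sum, Finset.sum_mul_sum]
    refine Finset.sum_congr rfl fun u _ => Finset.sum_congr rfl fun u' _ => ?_
    simp only [star_mul']
    ring
  simp_rw [h]
  rw [Finset.sum_comm]
  simp_rw [Finset.sum_comm (s := (Finset.univ : Finset Λ)), ← Finset.sum_mul, B.sum_star_mul]
  by_cases hi : i = i'
  · simpa [hi] using hW
  · simp [hi]

/-- The amplitude of the computational basis state `q` of `m + 1` bunches in the product of the bras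
onto which Bob projects them: bunch `x` is projected onto the normalised vectorisation of `W x`. -/
noncomputable def bunchVector (W : Fin (m + 1) → Matrix.unitaryGroup D ℂ)
    (q : Fin (m + 1) → D × D) : ℂ :=
  ∏ x, entNorm D * W x (q x).2 (q x).1

theorem sum_bunchVector [Nonempty D] (B : ErrorBasis D Λ)
    (U : Fin (m + 1) → Matrix.unitaryGroup D ℂ) (q q' : Fin (m + 1) → D × D) :
    ∑ a : Fin (m + 1) → Λ, star (bunchVector (fun x => B.op (a x) * U x) q) *
      bunchVector (fun x => B.op (a x) * U x) q' = if q = q' then 1 else 0 := by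
  simp only [bunchVector, star_prod, ← Finset.prod_mul_distrib]
  rw [← Fintype.piFinset_univ, ← Finset.prod_univ_sum (fun _ => Finset.univ)
    (fun x a => star (entNorm D * (B.op a * U x : Matrix.unitaryGroup D ℂ) (q x).2 (q x).1) *
      (entNorm D * (B.op a * U x : Matrix.unitaryGroup D ℂ) (q' x).2 (q' x).1))]
  simp only [B.sum_star_mul_unitary]
  split_ifs with h
  · simp [h]
  · obtain ⟨x, hx⟩ := Function.ne_iff.1 h
    exact Finset.prod_eq_zero (Finset.mem_univ x)
      (if_neg fun hh => hx (Prod.ext hh.2 hh.1))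

/-- Alice's Kraus operator in a gate teleportation through bunch `x`: the bunches other than `x`
are measured in the computational basis, with result `τ`, the state and the first half of bunch
`x` are measured in the basis of the vectorised operators of `B`, with result `a`, and `G` acts on
the second half of bunch `x` and the remaining resource. -/
noncomputable def teleportKraus (B : ErrorBasis D Λ) (x : Fin (m + 1)) (τ : Fin m → D × D) (a : Λ)
    (G : Matrix D (D × R) ℂ) : Matrix D (D × ((Fin (m + 1) → D × D) × R)) ℂ :=
  Matrix.of fun o p => if x.removeNth p.2.1 = τ then
    entNorm D * B.op a (p.2.1 x).1 p.1 * G o ((p.2.1 x).2, p.2.2) else 0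

theorem teleportKraus_complete [Nonempty D] [DecidableEq R] [Fintype K]
    (B : ErrorBasis D Λ) (x : Fin (m + 1)) (G : Λ → K → Matrix D (D × R) ℂ)
    (hG : ∀ a i j, ∑ k, ∑ o, star (G a k o i) * G a k o j = if i = j then 1 else 0)
    (i j : D × ((Fin (m + 1) → D × D) × R)) :
    ∑ k : (Fin m → D × D) × Λ × K, ∑ o, star (teleportKraus B x k.1 k.2.1 (G k.2.1 k.2.2) o i) *
      teleportKraus B x k.1 k.2.1 (G k.2.1 k.2.2) o j = if i = j then 1 else 0 := by
  obtain ⟨i, q, r⟩ := i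
  obtain ⟨j, q', r'⟩ := j
  have h : ∀ τ a k o, star (teleportKraus B x τ a (G a k) o (i, q, r)) *
      teleportKraus B x τ a (G a k) o (j, q', r') =
      (if x.removeNth q = τ then if x.removeNth q' = τ then (1 : ℂ) else 0 else 0) *
      ((star (entNorm D * B.op a (q x).1 i) * (entNorm D * B.op a (q' x).1 j)) *
        (star (G a k o ((q x).2, r)) * G a k o ((q' x).2, r'))) := by
    intro τ a k o
    simp only [teleportKraus, Matrix.of_apply]
    split_ifs
    · simp only [star_mul']
      ring
    all_goals simp
  have hs : ∀ τ a, ∑ k, ∑ o, star (teleportKraus B x τ a (G a k) o (i, q, r)) *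
      teleportKraus B x τ a (G a k) o (j, q', r') =
      (if x.removeNth q = τ then if x.removeNth q' = τ then (1 : ℂ) else 0 else 0) *
      ((star (entNorm D * B.op a (q x).1 i) * (entNorm D * B.op a (q' x).1 j)) *
        (if ((q x).2, r) = ((q' x).2, r') then 1 else 0)) := by
    intro τ a
    simp only [h, ← hG a, Finset.mul_sum]
  simp only [Fintype.sum_prod_type, hs]
  simp only [← Finset.mul_sum, ← Finset.sum_mul]
  rw [B.sum_star_mul]
  have hq : q = q' ↔ q x = q' x ∧ x.removeNth q' = x.removeNth q := by
    rw [eq_comm (a := x.removeNth q'), ← Fin.eq_insertNth_iff, Fin.insertNth_self_removeNth]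
  by_cases h1 : x.removeNth q' = x.removeNth q <;> by_cases h2 : (q x).1 = (q' x).1 <;>
    by_cases h3 : (q x).2 = (q' x).2 <;> by_cases h4 : i = j <;> by_cases h5 : r = r' <;>
    simp [hq, Prod.ext_iff, h1, h2, h3, h4, h5]

/-- The amplitude of the computational basis state `τ` of the bunches other than `x`. -/
noncomputable def trashAmp (W : Fin (m + 1) → Matrix.unitaryGroup D ℂ) (x : Fin (m + 1))
    (τ : Fin m → D × D) : ℂ :=
  ∏ j, entNorm D * W (x.succAbove j) (τ j).2 (τ j).1

theorem sum_norm_trashAmp_sq [Nonempty D] (W : Fin (m + 1) → Matrix.unitaryGroup D ℂ)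
    (x : Fin (m + 1)) : ∑ τ, ‖trashAmp W x τ‖ ^ 2 = 1 := by
  simp only [trashAmp, norm_prod, ← Finset.prod_pow]
  rw [← Fintype.piFinset_univ, ← Finset.prod_univ_sum (fun _ => Finset.univ)
    (fun j (p : D × D) => ‖entNorm D * W (x.succAbove j) p.2 p.1‖ ^ 2)]
  refine Finset.prod_eq_one fun j _ => ?_
  simp only [norm_mul, mul_pow, ← Finset.mul_sum, sum_norm_sq_unitary, norm_entNorm_sq]
  exact inv_mul_cancel₀ (Nat.cast_ne_zero.2 Fintype.card_ne_zero)

/-- Gate teleportation: the state undergoes the basis operator `a`, the unitary in bunch `x`, and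
then whatever is done with the rest of the resource. -/
theorem transfer_teleportKraus [Fintype R] (B : ErrorBasis D Λ) (x : Fin (m + 1))
    (τ : Fin m → D × D) (a : Λ) (G : Matrix D (D × R) ℂ)
    (W : Fin (m + 1) → Matrix.unitaryGroup D ℂ) (β : R → ℂ) :
    transfer (teleportKraus B x τ a G) (fun p => bunchVector W p.1 * β p.2) =
      (entNorm D * entNorm D * trashAmp W x τ) •
        (transfer G β * ((W x : Matrix D D ℂ) * (B.op a : Matrix D D ℂ))) := by
  ext o i
  simp only [transfer, Matrix.smul_apply, Matrix.mul_apply, Matrix.of_apply, smul_eq_mul,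
    Fintype.sum_prod_type]
  rw [← (Fin.insertNthEquiv (fun _ => D × D) x).sum_comp]
  have h : ∀ (p : (D × D) × (Fin m → D × D)) (r : R),
      teleportKraus B x τ a G o (i, (Fin.insertNthEquiv (fun _ => D × D) x p, r)) *
        (bunchVector W (Fin.insertNthEquiv (fun _ => D × D) x p) * β r) =
      if p.2 = τ then entNorm D * entNorm D * trashAmp W x τ *
        ((G o (p.1.2, r) * β r) * (W x p.1.2 p.1.1 * B.op a p.1.1 i)) else 0 := by
    rintro ⟨p, τ'⟩ r
    simp only [teleportKraus, Matrix.of_apply, Fin.insertNthEquiv, Equiv.coe_fn_mk,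
      Fin.removeNth_insertNth, Fin.insertNth_apply_same, bunchVector,
      Fin.prod_univ_succAbove _ x, Fin.insertNth_apply_succAbove]
    split_ifs with hτ
    · subst hτ
      rw [trashAmp]
      ring
    · simp
  simp only [h]
  rw [Fintype.sum_prod_type]
  simp only [Finset.sum_ite_irrel, Finset.sum_const_zero, Finset.sum_ite_eq', Finset.mem_univ,
    if_true, ← Finset.mul_sum, Fintype.sum_prod_type]
  congr 1
  rw [Finset.sum_comm]
  refine Finset.sum_congr rfl fun t _ => ?_
  rw [Finset.sum_mul_sum, Finset.sum_comm]

end Teleport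

/-! ### Iterated gate teleportation -/

section Step

variable {D Λ R : Type} [Fintype D] [DecidableEq D] [Fintype Λ] [DecidableEq Λ]
  [Fintype R] [DecidableEq R] {X Y : Type} {m : ℕ}

/-- The unitary that remains to be applied after a gate teleportation of `U x y` with results `p.2`
for Alice and `q.2` for Bob, so that the state has undergone `P (q.2 x) * U x y * P p.2`. -/
def correction (B : ErrorBasis D Λ) (U : X → Y → Matrix.unitaryGroup D ℂ) (p : X × Λ)
    (q : Y × (X → Λ)) : Matrix.unitaryGroup D ℂ :=
  U p.1 q.1 * (B.op (q.2 p.1) * U p.1 q.1 * B.op p.2)⁻¹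

/-- What Alice does after a gate teleportation with result `a`: if it is the identity, she keeps the
teleported state and measures the remaining resource in the computational basis; otherwise she
continues with `A a`. -/
def continueKraus {K : Type} (B : ErrorBasis D Λ) (A : Λ → K → Matrix D (D × R) ℂ) (a : Λ) :
    R ⊕ K → Matrix D (D × R) ℂ
  | .inl r => if a = B.unit then Matrix.of fun o p => if p = (o, r) then 1 else 0 else 0
  | .inr k => if a = B.unit then 0 else A a k

theorem continueKraus_complete {K : Type} [Fintype K] (B : ErrorBasis D Λ)
    (A : Λ → K → Matrix D (D × R) ℂ)
    (hA : ∀ a i j, ∑ k, ∑ o, star (A a k o i) * A a k o j = if i = j then 1 else 0) (a : Λ)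
    (i j : D × R) :
    ∑ k, ∑ o, star (continueKraus B A a k o i) * continueKraus B A a k o j =
      if i = j then 1 else 0 := by
  rw [Fintype.sum_sum_type]
  by_cases ha : a = B.unit
  · simpa [continueKraus, ha] using computationalKraus_complete i j
  · simpa [continueKraus, ha] using hA a i j

/-- One round of gate teleportation. Every bunch is used for one value of Alice's input. With
probability `1 / |D|²` her result is the identity and she is done; otherwise the remaining scheme
`S` applies the correction, whose dependence on the results of the round is absorbed into the
inputs. -/
noncomputable def Scheme.step [Nonempty D] {B : ErrorBasis D Λ}
    {U : Fin (m + 1) → Y → Matrix.unitaryGroup D ℂ} {δ : ℝ} (S : Scheme B R (correction B U) δ) :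
    Scheme B ((Fin (m + 1) → D × D) × R) U ((1 - ((Fintype.card D : ℝ) ^ 2)⁻¹) * δ) where
  K := (Fin m → D × D) × Λ × (R ⊕ S.K)
  L := (Fin (m + 1) → Λ) × S.L
  alice x k := teleportKraus B x k.1 k.2.1
    (continueKraus B (fun a => S.alice (x, a)) k.2.1 k.2.2)
  bob y l p := bunchVector (fun x => B.op (l.1 x) * U x y) p.1 * S.bob (y, l.1) l.2 p.2
  alice_complete x := teleportKraus_complete B x _
    (continueKraus_complete B _ fun a => S.alice_complete (x, a))
  bob_complete y := by
    rintro ⟨q, r⟩ ⟨q', r'⟩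
    have h : ∀ l : (Fin (m + 1) → Λ) × S.L,
        star (bunchVector (fun x => B.op (l.1 x) * U x y) q * S.bob (y, l.1) l.2 r) *
          (bunchVector (fun x => B.op (l.1 x) * U x y) q' * S.bob (y, l.1) l.2 r') =
        (star (bunchVector (fun x => B.op (l.1 x) * U x y) q) *
          bunchVector (fun x => B.op (l.1 x) * U x y) q') *
          (star (S.bob (y, l.1) l.2 r) * S.bob (y, l.1) l.2 r') := by
      intro l
      rw [star_mul']
      ring
    simp only [h, Fintype.sum_prod_type, ← Finset.mul_sum, S.bob_complete, ← Finset.sum_mul,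
      sum_bunchVector, Prod.mk.injEq]
    by_cases h1 : q = q' <;> by_cases h2 : r = r' <;> simp [h1, h2]
  label x y k l := match k.2.2 with
    | .inl _ => l.1 x
    | .inr k' => S.label (x, k.2.1) (y, l.1) k' l.2
  amp x y k l := entNorm D * entNorm D * trashAmp (fun x => B.op (l.1 x) * U x y) x k.1 *
    match k.2.2 with
    | .inl r => if k.2.1 = B.unit then S.bob (y, l.1) l.2 r else 0
    | .inr k' => if k.2.1 = B.unit then 0 else S.amp (x, k.2.1) (y, l.1) k' l.2
  implements x y := by
    rintro ⟨τ, a, k⟩ ⟨b, l⟩ hne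
    rw [transfer_teleportKraus]
    rcases k with r | k
    · have ha : a = B.unit := by
        by_contra ha
        simp [ha] at hne
      subst ha
      simp [continueKraus, transfer_computationalKraus, B.op_unit, smul_smul]
    · have ha : a ≠ B.unit := by
        intro ha
        simp [ha] at hne
      have hS : S.amp (x, a) (y, b) k l ≠ 0 := by
        intro h0
        simp [h0] at hne
      have hU : (correction B U (x, a) (y, b) : Matrix.unitaryGroup D ℂ) *
          (B.op (b x) * U x y * B.op a) = U x y :=
        inv_mul_cancel_right _ _
      have hU' : (correction B U (x, a) (y, b) : Matrix D D ℂ) *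
          ((B.op (b x) * U x y : Matrix.unitaryGroup D ℂ) * (B.op a : Matrix D D ℂ)) = U x y :=
        congrArg Subtype.val hU
      simp only [continueKraus, if_neg ha, S.implements _ _ _ _ hS, Matrix.smul_mul, smul_smul,
        Matrix.mul_assoc _ (correction B U (x, a) (y, b) : Matrix D D ℂ), hU']
  weight x y := by
    set d : ℝ := (Fintype.card D : ℝ) with hd
    have hd0 : d ≠ 0 := Nat.cast_ne_zero.2 Fintype.card_ne_zero
    have hbob : ∀ b : Fin (m + 1) → Λ, ∑ r, ∑ l, ‖S.bob (y, b) l r‖ ^ 2 = Fintype.card R := by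
      intro b
      have h : ∀ r, ∑ l, ‖S.bob (y, b) l r‖ ^ 2 = 1 := by
        intro r
        have h1 : ((∑ l, ‖S.bob (y, b) l r‖ ^ 2 : ℝ) : ℂ) = 1 := by
          rw [← (S.bob_complete (y, b) r r).trans (if_pos rfl)]
          push_cast
          exact Finset.sum_congr rfl fun l _ => (RCLike.conj_mul _).symm
        exact_mod_cast h1
      simp [h]
    -- The weight of the results of the remaining scheme, given the result `a` of the teleportation.
    set T : (Fin (m + 1) → Λ) → S.L → Λ → R ⊕ S.K → ℂ := fun b l a k => match k with
      | .inl r => if a = B.unit then S.bob (y, b) l r else 0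
      | .inr k' => if a = B.unit then 0 else S.amp (x, a) (y, b) k' l with hT
    have hTsum : ∀ b a, ∑ k, ∑ l, ‖T b l a k‖ ^ 2 =
        (1 - δ) * Fintype.card R + if a = B.unit then δ * Fintype.card R else 0 := by
      intro b a
      rw [Fintype.sum_sum_type]
      by_cases ha : a = B.unit
      · simp only [hT, ha, if_true, hbob]
        simp
        ring
      · simp only [hT, ha, if_false, S.weight]
        simp
    have hterm : ∀ (τ : Fin m → D × D) (a : Λ) (k : R ⊕ S.K) (b : Fin (m + 1) → Λ) (l : S.L),
        ‖entNorm D * entNorm D * trashAmp (fun x => B.op (b x) * U x y) x τ * T b l a k‖ ^ 2 =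
        (d⁻¹ * d⁻¹) * (‖trashAmp (fun x => B.op (b x) * U x y) x τ‖ ^ 2 * ‖T b l a k‖ ^ 2) := by
      intro τ a k b l
      rw [norm_mul, norm_mul, norm_mul, mul_pow, mul_pow, mul_pow, norm_entNorm_sq]
      ring
    calc _ = ∑ k : (Fin m → D × D) × Λ × (R ⊕ S.K), ∑ l : (Fin (m + 1) → Λ) × S.L,
          (d⁻¹ * d⁻¹) * (‖trashAmp (fun x => B.op (l.1 x) * U x y) x k.1‖ ^ 2 *
            ‖T l.1 l.2 k.2.1 k.2.2‖ ^ 2) :=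
          Finset.sum_congr rfl fun k _ => Finset.sum_congr rfl fun l _ => hterm _ _ _ _ _
      _ = (d⁻¹ * d⁻¹) * ∑ b : Fin (m + 1) → Λ,
          (∑ τ, ‖trashAmp (fun x => B.op (b x) * U x y) x τ‖ ^ 2) *
            ∑ a, ∑ k, ∑ l, ‖T b l a k‖ ^ 2 := by
          rw [Finset.sum_comm, Fintype.sum_prod_type, Finset.mul_sum]
          refine Finset.sum_congr rfl fun b _ => ?_
          rw [Finset.sum_comm]
          simp only [Fintype.sum_prod_type, ← Finset.mul_sum, ← Finset.sum_mul]
      _ = _ := by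
          simp only [sum_norm_trashAmp_sq, hTsum]
          simp only [Finset.sum_add_distrib, Finset.sum_const, Finset.card_univ, B.card_eq,
            Finset.sum_ite_eq', Finset.mem_univ, if_true, Fintype.card_prod, Fintype.card_fun,
            Fintype.card_fin, nsmul_eq_mul]
          push_cast
          rw [← hd]
          field_simp
          ring

/-- After `t` rounds of gate teleportation the scheme fails only if all their results differ from
the identity. The shared state can be taken on any sufficiently large number of qubits. -/
theorem exists_scheme (B : ErrorBasis D Λ) {n : ℕ} (hD : Fintype.card D = 2 ^ n) (t : ℕ) :
    ∀ (X Y : Type) [Finite X] [Nonempty X] (U : X → Y → Matrix.unitaryGroup D ℂ),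
      ∃ N₀ : ℕ, ∀ N, N₀ ≤ N →
        Nonempty (Scheme B (Reg N) U ((1 - ((Fintype.card D : ℝ) ^ 2)⁻¹) ^ t)) := by
  have : Nonempty D := Fintype.card_pos_iff.1 (by rw [hD]; positivity)
  induction t with
  | zero =>
    intro X Y _ _ U
    exact ⟨0, fun N _ => ⟨by simpa using Scheme.trivial B (Reg N) U⟩⟩
  | succ t ih =>
    intro X Y _ _ U
    obtain ⟨p, ⟨e⟩⟩ := Finite.exists_equiv_fin X
    obtain ⟨m, rfl⟩ : ∃ m, p = m + 1 := by
      refine Nat.exists_eq_succ_of_ne_zero ?_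
      rintro rfl
      exact (e (Classical.arbitrary X)).elim0
    have : Nonempty Λ := ⟨B.unit⟩
    obtain ⟨N₀, hN₀⟩ := ih (Fin (m + 1) × Λ) (Y × (Fin (m + 1) → Λ))
      (correction B fun i y => U (e.symm i) y)
    refine ⟨N₀ + (n + n) * (m + 1), fun N hN => ?_⟩
    obtain ⟨M, rfl⟩ : ∃ M, N = M + (n + n) * (m + 1) :=
      ⟨N - (n + n) * (m + 1), by omega⟩
    obtain ⟨S⟩ := hN₀ M (by omega)
    have r : (Fin (m + 1) → D × D) × Reg M ≃ Reg (M + (n + n) * (m + 1)) := by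
      refine Fintype.equivOfCardEq ?_
      simp only [Fintype.card_prod, Fintype.card_fun, Fintype.card_fin, hD]
      rw [← pow_add, ← pow_mul, ← pow_add, add_comm]
    have S' := (S.step.reindex r).comap e
    simp only [Equiv.symm_apply_apply] at S'
    rw [pow_succ']
    exact ⟨S'⟩

end Step

/-! ### Local operations on shared EPR pairs -/

section EPR

variable {nA nB N : ℕ} {K L : Type*} [Fintype K] [Fintype L]
  {H : Type*} [NormedAddCommGroup H] [InnerProductSpace ℂ H]

theorem prod_epr (s t : Reg N) :
    ∏ j, epr (s j) (t j) = if s = t then entNorm (Reg N) else 0 := by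
  split_ifs with h
  · subst h
    simp only [epr, if_true, Finset.prod_const, Finset.card_univ, Fintype.card_fin, entNorm,
      Fintype.card_fun]
    push_cast
    rw [inv_pow, ← Complex.ofReal_pow]
    congr 2
    symm
    rw [Real.sqrt_eq_iff_mul_self_eq (by positivity) (by positivity), ← mul_pow,
      Real.mul_self_sqrt zero_le_two]
  · obtain ⟨i, hi⟩ := Function.ne_iff.1 h
    exact Finset.prod_eq_zero (Finset.mem_univ i) (by simp [epr, hi])

theorem norm_withEPR_sq (ψ : Joint (Reg nA × Reg nB) H) : ‖withEPR N ψ‖ ^ 2 = ‖ψ‖ ^ 2 := by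
  rw [PiLp.norm_sq_eq_of_L2, PiLp.norm_sq_eq_of_L2]
  have h : ∀ s t : Reg N, ‖if s = t then entNorm (Reg N) else 0‖ ^ 2 =
      if s = t then ((Fintype.card (Reg N) : ℝ))⁻¹ else 0 := by
    intro s t
    split_ifs <;> simp [norm_entNorm_sq]
  have h0 : ∀ c : ℝ, (Fintype.card (Reg N) : ℝ) * ((Fintype.card (Reg N) : ℝ)⁻¹ * c) = c :=
    fun c => mul_inv_cancel_left₀ (Nat.cast_ne_zero.2 Fintype.card_ne_zero) c
  simp only [withEPR, Fintype.sum_prod_type, prod_epr, norm_smul, mul_pow, h, ite_mul, zero_mul,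
    Finset.sum_ite_eq, Finset.mem_univ, if_true, Finset.sum_const, Finset.card_univ, nsmul_eq_mul,
    ← Finset.mul_sum]
  rw [mul_left_comm, h0]

/-- The operator on `AB` that results, up to the normalisation `2 ^ (-N/2)`, from a Kraus operator
of each party. -/
def jointOp (A : Matrix (Reg nA) (Reg nA × Reg N) ℂ) (B : Matrix (Reg nB) (Reg nB × Reg N) ℂ) :
    Matrix (Reg nA × Reg nB) (Reg nA × Reg nB) ℂ :=
  Matrix.of fun o i => ∑ s, A o.1 (i.1, s) * B o.2 (i.2, s)

theorem rawOutput_eq (𝒜 : LocalOp nA N K) (ℬ : LocalOp nB N L) (ψ : Joint (Reg nA × Reg nB) H)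
    (k : K) (l : L) : rawOutput 𝒜 ℬ ψ k l =
      entNorm (Reg N) • applyOp (jointOp (𝒜.kraus k) (ℬ.kraus l)) ψ := by
  ext o
  simp only [rawOutput, applyOp, withEPR, jointOp, prod_epr, Matrix.kroneckerMap_apply,
    Matrix.of_apply, PiLp.smul_apply, Finset.smul_sum, Finset.sum_smul, Fintype.sum_prod_type,
    ite_smul, zero_smul, smul_ite, smul_zero, Finset.sum_ite_eq, Finset.mem_univ, if_true]
  refine Finset.sum_congr rfl fun a _ => ?_
  rw [Finset.sum_comm]
  refine Finset.sum_congr rfl fun b _ => Finset.sum_congr rfl fun s _ => ?_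
  rw [smul_comm]

theorem sum_outputProb (𝒜 : LocalOp nA N K) (ℬ : LocalOp nB N L)
    (ψ : Joint (Reg nA × Reg nB) H) : ∑ k, ∑ l, outputProb 𝒜 ℬ ψ k l = ‖ψ‖ ^ 2 := by
  rw [← norm_withEPR_sq (N := N), ← sum_norm_applyOp_sq
    (fun p : K × L => 𝒜.kraus p.1 ⊗ₖ ℬ.kraus p.2) ?_ (withEPR N ψ), Fintype.sum_prod_type]
  · rfl
  · simp only [Matrix.conjTranspose_kronecker, ← Matrix.mul_kronecker_mul, Fintype.sum_prod_type]
    have h : ∀ k, ∑ l, ((𝒜.kraus k)ᴴ * 𝒜.kraus k) ⊗ₖ ((ℬ.kraus l)ᴴ * ℬ.kraus l) =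
        ((𝒜.kraus k)ᴴ * 𝒜.kraus k) ⊗ₖ (1 : Matrix (Reg nB × Reg N) (Reg nB × Reg N) ℂ) := by
      intro k
      rw [← ℬ.complete]
      ext i j
      simp [Matrix.sum_apply, Finset.mul_sum]
    simp only [h]
    rw [show (1 : Matrix ((Reg nA × Reg N) × (Reg nB × Reg N)) _ ℂ) = 1 ⊗ₖ 1 from
      Matrix.one_kronecker_one.symm, ← 𝒜.complete]
    ext i j
    simp only [Matrix.sum_apply, Matrix.kroneckerMap_apply, Finset.sum_mul]

end EPR

/-! ### Corrections after the exchange of the classical outputs -/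

/-- The phase by which a complex number has to be multiplied to become its absolute value. -/
noncomputable def phase (c : ℂ) : ℂ := if c = 0 then 1 else (‖c‖ : ℂ) / c

theorem norm_phase (c : ℂ) : ‖phase c‖ = 1 := by
  unfold phase
  split_ifs with h
  · simp
  · simp [h]

theorem phase_mul (c : ℂ) : phase c * c = ‖c‖ := by
  unfold phase
  split_ifs with h
  · simp [h]
  · exact div_mul_cancel₀ _ h

section Corrections

variable {nA nB M : ℕ} {X Y : Type} {U : X → Y → Matrix.unitaryGroup (Reg nA × Reg nB) ℂ} {δ : ℝ}

/-- The unitary that Alice has to apply to the whole state after Bob has teleported his part to her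
with the result `q.2`. -/
noncomputable def afterTeleport (U : X → Y → Matrix.unitaryGroup (Reg nA × Reg nB) ℂ) (x : X)
    (q : Y × (Fin nB → Fin 4)) : Matrix.unitaryGroup (Reg nA × Reg nB) ℂ :=
  U x q.1 * (kronUnitary 1 ((pauliBasis nB).op q.2))⁻¹

variable (S : Scheme ((pauliBasis nA).prod (pauliBasis nB)) (Reg M) (afterTeleport U) δ)

/-- Alice's correction. It contains the phase of the amplitude of the classical outputs, which both
parties know once these are exchanged, since they contain both inputs. -/
noncomputable def correctionA (k : X × S.K × (Fin nB → Fin 4)) (l : Y × (Fin nB → Fin 4) × S.L) :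
    Matrix (Reg nA) (Reg nA) ℂ :=
  phase (S.amp k.1 (l.1, l.2.1) k.2.1 l.2.2) •
    ((pauliBasis nA).op (S.label k.1 (l.1, l.2.1) k.2.1 l.2.2).1 : Matrix (Reg nA) (Reg nA) ℂ)ᴴ

/-- Bob's correction: the inverse of the operator left over by the scheme, and of the one left
over by the teleportation of his output. -/
noncomputable def correctionB (k : X × S.K × (Fin nB → Fin 4)) (l : Y × (Fin nB → Fin 4) × S.L) :
    Matrix (Reg nB) (Reg nB) ℂ :=
  ((pauliBasis nB).op (S.label k.1 (l.1, l.2.1) k.2.1 l.2.2).2 : Matrix (Reg nB) (Reg nB) ℂ)ᴴ *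
    ((pauliBasis nB).op k.2.2 : Matrix (Reg nB) (Reg nB) ℂ)ᴴ

theorem isPauliProduct_correctionA (k : X × S.K × (Fin nB → Fin 4))
    (l : Y × (Fin nB → Fin 4) × S.L) : IsPauliProduct (correctionA S k l) :=
  (isPauliProduct_pauliBasis _).conjTranspose.smul (norm_phase _)

theorem isPauliProduct_correctionB (k : X × S.K × (Fin nB → Fin 4))
    (l : Y × (Fin nB → Fin 4) × S.L) : IsPauliProduct (correctionB S k l) :=
  (isPauliProduct_pauliBasis _).conjTranspose.mul (isPauliProduct_pauliBasis _).conjTranspose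

/-- The operator that the whole protocol applies after `U x y`: the one left over by the scheme,
with index `a`, followed by the one left over by the teleportation of Bob's output, with index
`m'`. -/
noncomputable def leftover (a : (Fin nA → Fin 4) × (Fin nB → Fin 4)) (m' : Fin nB → Fin 4) :
    Matrix.unitaryGroup (Reg nA × Reg nB) ℂ :=
  kronUnitary 1 ((pauliBasis nB).op m') * ((pauliBasis nA).prod (pauliBasis nB)).op a

theorem correction_mul_leftover (x : X) (y : Y) (k : S.K) (m' m : Fin nB → Fin 4) (l : S.L) :
    (correctionA S (x, k, m') (y, m, l) ⊗ₖ correctionB S (x, k, m') (y, m, l)) *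
      ((leftover (S.label x (y, m) k l) m' : Matrix.unitaryGroup (Reg nA × Reg nB) ℂ) :
        Matrix _ _ ℂ) = phase (S.amp x (y, m) k l) • 1 := by
  have hu : ∀ {n : ℕ} (V : Matrix.unitaryGroup (Reg n) ℂ),
      (V : Matrix (Reg n) (Reg n) ℂ)ᴴ * (V : Matrix (Reg n) (Reg n) ℂ) = 1 :=
    fun V => Matrix.UnitaryGroup.star_mul_self V
  have hu' : ∀ {n : ℕ} (V : Matrix.unitaryGroup (Reg n) ℂ) (T : Matrix (Reg n) (Reg n) ℂ),
      (V : Matrix (Reg n) (Reg n) ℂ)ᴴ * ((V : Matrix (Reg n) (Reg n) ℂ) * T) = T := by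
    intro n V T
    rw [← Matrix.mul_assoc, hu, Matrix.one_mul]
  simp only [correctionA, correctionB, leftover, Matrix.smul_kronecker, Matrix.smul_mul,
    Matrix.UnitaryGroup.mul_val, kronUnitary, ErrorBasis.prod, Matrix.UnitaryGroup.one_val,
    ← Matrix.mul_kronecker_mul, one_mul, Matrix.mul_assoc, hu', hu, Matrix.one_kronecker_one]

end Corrections

/-! ### Teleporting Bob's part to Alice and back -/

section Localise

variable {nA nB N M : ℕ} {X Y : Type} [DecidableEq X] [DecidableEq Y] [Fintype X] [Fintype Y]
  {U : X → Y → Matrix.unitaryGroup (Reg nA × Reg nB) ℂ} {δ : ℝ}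
  (S : Scheme ((pauliBasis nA).prod (pauliBasis nB)) (Reg M) (afterTeleport U) δ)
  (e : Reg N ≃ (Reg nB × Reg nB) × Reg M)

/-- Alice's local operation: she receives Bob's part of the state through the first group of `nB`
EPR pairs, acts by the scheme, and sends his part back through the second group. Her output
contains her input `x`. -/
noncomputable def aliceOp (x : X) : LocalOp nA N (X × S.K × (Fin nB → Fin 4)) where
  kraus k := if k.1 = x then Matrix.of fun o p => ∑ b, S.alice x k.2.1 (o, b)
    ((p.1, (e p.2).1.1), (e p.2).2) *
      (entNorm (Reg nB) * (pauliBasis nB).op k.2.2 (e p.2).1.2 b) else 0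
  complete := by
    rw [sum_conjTranspose_mul_eq_one_iff]
    rintro ⟨a, s⟩ ⟨a', s'⟩
    rw [Fintype.sum_prod_type, Finset.sum_eq_single x (by intro _ _ h; simp [h]) (by simp)]
    simp only [if_true, Fintype.sum_prod_type, Matrix.of_apply, star_sum]
    have h : ∀ k m o, (∑ b, star (S.alice x k (o, b) ((a, (e s).1.1), (e s).2) *
          (entNorm (Reg nB) * (pauliBasis nB).op m (e s).1.2 b))) *
        (∑ b, S.alice x k (o, b) ((a', (e s').1.1), (e s').2) *
          (entNorm (Reg nB) * (pauliBasis nB).op m (e s').1.2 b)) =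
        ∑ b, ∑ b', (star (S.alice x k (o, b) ((a, (e s).1.1), (e s).2)) *
          S.alice x k (o, b') ((a', (e s').1.1), (e s').2)) *
          (star (entNorm (Reg nB) * (pauliBasis nB).op m (e s).1.2 b) *
            (entNorm (Reg nB) * (pauliBasis nB).op m (e s').1.2 b')) := by
      intro k m o
      rw [Finset.sum_mul_sum]
      refine Finset.sum_congr rfl fun b _ => Finset.sum_congr rfl fun b' _ => ?_
      simp only [star_mul']
      ring
    have h2 : ∀ k, ∑ m, ∑ o, (∑ b, star (S.alice x k (o, b) ((a, (e s).1.1), (e s).2) *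
          (entNorm (Reg nB) * (pauliBasis nB).op m (e s).1.2 b))) *
        (∑ b, S.alice x k (o, b) ((a', (e s').1.1), (e s').2) *
          (entNorm (Reg nB) * (pauliBasis nB).op m (e s').1.2 b)) =
        (∑ o, ∑ b, star (S.alice x k (o, b) ((a, (e s).1.1), (e s).2)) *
          S.alice x k (o, b) ((a', (e s').1.1), (e s').2)) *
          if (e s).1.2 = (e s').1.2 then 1 else 0 := by
      intro k
      simp only [h]
      rw [Finset.sum_comm, Finset.sum_mul]
      refine Finset.sum_congr rfl fun o _ => ?_
      rw [Finset.sum_comm, Finset.sum_mul]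
      refine Finset.sum_congr rfl fun b _ => ?_
      rw [Finset.sum_comm]
      simp only [← Finset.mul_sum, ErrorBasis.sum_star_mul, ite_and]
      by_cases hs : (e s).1.2 = (e s').1.2 <;> simp [hs]
    simp only [h2, ← Finset.sum_mul]
    have hS := S.alice_complete x ((a, (e s).1.1), (e s).2) ((a', (e s').1.1), (e s').2)
    simp only [Fintype.sum_prod_type] at hS
    rw [hS]
    have hs : s = s' ↔ (e s).1.1 = (e s').1.1 ∧ (e s).1.2 = (e s').1.2 ∧ (e s).2 = (e s').2 := by
      rw [← e.apply_eq_iff_eq, Prod.ext_iff, Prod.ext_iff, and_assoc]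
    simp only [Prod.mk.injEq, hs]
    by_cases h1 : a = a' <;> by_cases h3 : (e s).1.1 = (e s').1.1 <;>
      by_cases h4 : (e s).1.2 = (e s').1.2 <;> by_cases h5 : (e s).2 = (e s').2 <;>
      simp [h1, h3, h4, h5]

/-- Bob's local operation: he sends his part of the state to Alice through the first group of `nB`
EPR pairs, measures his half of the resource of the scheme, and takes his halves of the second
group as his output. His classical output contains his input `y`. -/
noncomputable def bobOp (y : Y) : LocalOp nB N (Y × (Fin nB → Fin 4) × S.L) where
  kraus l := if l.1 = y then Matrix.of fun o p => if (e p.2).1.2 = o then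
    entNorm (Reg nB) * (pauliBasis nB).op l.2.1 (e p.2).1.1 p.1 *
      S.bob (y, l.2.1) l.2.2 (e p.2).2 else 0 else 0
  complete := by
    rw [sum_conjTranspose_mul_eq_one_iff]
    rintro ⟨b, s⟩ ⟨b', s'⟩
    rw [Fintype.sum_prod_type, Finset.sum_eq_single y (by intro _ _ h; simp [h]) (by simp)]
    simp only [if_true, Fintype.sum_prod_type, Matrix.of_apply]
    have h : ∀ m l, ∑ o, star (if (e s).1.2 = o then entNorm (Reg nB) *
          (pauliBasis nB).op m (e s).1.1 b * S.bob (y, m) l (e s).2 else 0) *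
        (if (e s').1.2 = o then entNorm (Reg nB) *
          (pauliBasis nB).op m (e s').1.1 b' * S.bob (y, m) l (e s').2 else 0) =
        (if (e s').1.2 = (e s).1.2 then 1 else 0) *
        ((star (entNorm (Reg nB) * (pauliBasis nB).op m (e s).1.1 b) *
            (entNorm (Reg nB) * (pauliBasis nB).op m (e s').1.1 b')) *
          (star (S.bob (y, m) l (e s).2) * S.bob (y, m) l (e s').2)) := by
      intro m l
      rw [Finset.sum_eq_single (e s).1.2 (by intro _ _ h; simp [Ne.symm h]) (by simp),
        if_pos rfl]
      split_ifs
      · simp only [star_mul']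
        ring
      · simp
    simp only [h, ← Finset.mul_sum, S.bob_complete, ← Finset.sum_mul, ErrorBasis.sum_star_mul]
    have hs : s = s' ↔ (e s).1.1 = (e s').1.1 ∧ (e s').1.2 = (e s).1.2 ∧ (e s).2 = (e s').2 := by
      rw [← e.apply_eq_iff_eq, Prod.ext_iff, Prod.ext_iff, and_assoc, eq_comm (a := (e s').1.2)]
    simp only [Prod.mk.injEq, hs]
    by_cases h1 : b = b' <;> by_cases h3 : (e s).1.1 = (e s').1.1 <;>
      by_cases h4 : (e s').1.2 = (e s).1.2 <;> by_cases h5 : (e s).2 = (e s').2 <;>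
      simp [h1, h3, h4, h5]

theorem jointOp_aliceOp_bobOp (x : X) (y : Y) (k : S.K) (m' m : Fin nB → Fin 4) (l : S.L) :
    jointOp ((aliceOp S e x).kraus (x, k, m')) ((bobOp S e y).kraus (y, m, l)) =
      (entNorm (Reg nB) * entNorm (Reg nB)) •
        (((kronUnitary 1 ((pauliBasis nB).op m') : Matrix.unitaryGroup (Reg nA × Reg nB) ℂ) :
            Matrix (Reg nA × Reg nB) (Reg nA × Reg nB) ℂ) *
          transfer (S.alice x k) (S.bob (y, m) l) *
            ((kronUnitary 1 ((pauliBasis nB).op m) : Matrix.unitaryGroup (Reg nA × Reg nB) ℂ) :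
            Matrix (Reg nA × Reg nB) (Reg nA × Reg nB) ℂ)) := by
  ext ⟨ao, bo⟩ ⟨a, b⟩
  simp only [jointOp, aliceOp, bobOp, if_true, Matrix.of_apply]
  rw [← e.symm.sum_comp]
  simp only [Equiv.apply_symm_apply, Fintype.sum_prod_type, kronUnitary, transfer,
    Matrix.smul_apply, Matrix.mul_apply, Matrix.kroneckerMap_apply, Matrix.of_apply,
    Matrix.UnitaryGroup.one_val, Matrix.one_apply, smul_eq_mul, ite_mul, zero_mul, one_mul,
    mul_ite, mul_zero, Finset.sum_ite_irrel, Finset.sum_const_zero, Finset.sum_ite_eq,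
    Finset.sum_ite_eq', Finset.mem_univ, if_true, Finset.sum_mul, Finset.mul_sum]
  refine Finset.sum_congr rfl fun t _ => ?_
  rw [Finset.sum_comm]
  refine Finset.sum_congr rfl fun b' _ => Finset.sum_congr rfl fun r _ => ?_
  ring

theorem jointOp_of_amp_ne_zero {x : X} {y : Y} {k : S.K} {m : Fin nB → Fin 4} {l : S.L}
    (m' : Fin nB → Fin 4) (h : S.amp x (y, m) k l ≠ 0) :
    jointOp ((aliceOp S e x).kraus (x, k, m')) ((bobOp S e y).kraus (y, m, l)) =
      (entNorm (Reg nB) * entNorm (Reg nB) * S.amp x (y, m) k l) •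
        ((leftover (S.label x (y, m) k l) m' * U x y :
          Matrix.unitaryGroup (Reg nA × Reg nB) ℂ) : Matrix _ _ ℂ) := by
  rw [jointOp_aliceOp_bobOp, S.implements _ _ _ _ h, Matrix.mul_smul, Matrix.smul_mul, smul_smul]
  congr 1
  have : ∀ V P W T : Matrix.unitaryGroup (Reg nA × Reg nB) ℂ,
      V * (P * (W * T⁻¹)) * T = V * P * W := by
    intro V P W T
    group
  exact congrArg Subtype.val (this _ _ _ _)

variable {H : Type*} [NormedAddCommGroup H] [InnerProductSpace ℂ H]

theorem outputProb_of_amp_ne_zero (ψ : Joint (Reg nA × Reg nB) H) (hψ : ‖ψ‖ = 1)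
    {x : X} {y : Y} {k : S.K} {m : Fin nB → Fin 4} {l : S.L}
    (m' : Fin nB → Fin 4) (h : S.amp x (y, m) k l ≠ 0) :
    outputProb (aliceOp S e x) (bobOp S e y) ψ (x, k, m') (y, m, l) =
      (Fintype.card (Reg N) : ℝ)⁻¹ * ((Fintype.card (Reg nB) : ℝ)⁻¹ ^ 2 *
        ‖S.amp x (y, m) k l‖ ^ 2) := by
  rw [outputProb, rawOutput_eq, jointOp_of_amp_ne_zero S e m' h, applyOp_smul_left, norm_smul,
    norm_smul, norm_applyOp_unitary, hψ]
  simp only [norm_mul, mul_pow, norm_entNorm_sq]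
  ring

theorem applyOp_outputState (ψ : Joint (Reg nA × Reg nB) H) (hψ : ‖ψ‖ = 1)
    {x : X} {y : Y} {k : S.K} {m : Fin nB → Fin 4} {l : S.L}
    (m' : Fin nB → Fin 4) (h : S.amp x (y, m) k l ≠ 0) :
    applyOp (U x y : Matrix (Reg nA × Reg nB) _ ℂ) ψ =
      applyOp (correctionA S (x, k, m') (y, m, l) ⊗ₖ correctionB S (x, k, m') (y, m, l))
        (outputState (aliceOp S e x) (bobOp S e y) ψ (x, k, m') (y, m, l)) := by
  obtain ⟨g, hg, hg'⟩ : ∃ g : ℝ, 0 < g ∧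
      entNorm (Reg N) * (entNorm (Reg nB) * entNorm (Reg nB)) = g := by
    refine ⟨_, ?_, (by unfold entNorm; push_cast; rfl : _ =
      (((Real.sqrt (Fintype.card (Reg N)))⁻¹ * ((Real.sqrt (Fintype.card (Reg nB)))⁻¹ *
        (Real.sqrt (Fintype.card (Reg nB)))⁻¹) : ℝ) : ℂ))⟩
    have hc : ∀ n : ℕ, 0 < (Real.sqrt (Fintype.card (Reg n)))⁻¹ := fun n =>
      inv_pos.2 (Real.sqrt_pos.2 (Nat.cast_pos.2 Fintype.card_pos))
    exact mul_pos (hc _) (mul_pos (hc _) (hc _))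
  have hraw : rawOutput (aliceOp S e x) (bobOp S e y) ψ (x, k, m') (y, m, l) =
      (g * S.amp x (y, m) k l) • applyOp ((leftover (S.label x (y, m) k l) m' * U x y :
          Matrix.unitaryGroup (Reg nA × Reg nB) ℂ) : Matrix _ _ ℂ) ψ := by
    rw [rawOutput_eq, jointOp_of_amp_ne_zero S e m' h, applyOp_smul_left, smul_smul, ← mul_assoc,
      hg']
  have hnorm : ‖rawOutput (aliceOp S e x) (bobOp S e y) ψ (x, k, m') (y, m, l)‖ =
      g * ‖S.amp x (y, m) k l‖ := by
    rw [hraw, norm_smul, norm_applyOp_unitary, hψ, norm_mul, Complex.norm_real, Real.norm_eq_abs,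
      abs_of_pos hg, mul_one]
  rw [outputState, hnorm, hraw, smul_smul, applyOp_smul_right, ← applyOp_mul,
    Matrix.UnitaryGroup.mul_val, ← Matrix.mul_assoc, correction_mul_leftover, Matrix.smul_mul,
    Matrix.one_mul, applyOp_smul_left, smul_smul]
  have hc : (‖S.amp x (y, m) k l‖ : ℂ) ≠ 0 := by simpa using h
  have hg0 : (g : ℂ) ≠ 0 := by simpa using hg.ne'
  have : ((((g * ‖S.amp x (y, m) k l‖)⁻¹ : ℝ) : ℂ) * (g * S.amp x (y, m) k l)) *
      phase (S.amp x (y, m) k l) = 1 := by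
    rw [mul_assoc, mul_assoc, mul_comm (S.amp x (y, m) k l), phase_mul]
    push_cast
    exact inv_mul_cancel₀ (mul_ne_zero hg0 hc)
  rw [this, one_smul]

/-- The whole protocol fails with at most the failure probability of the scheme: the outputs that
are successful for the scheme have total probability `1 - δ`, and all probabilities add up to `1`.
-/
theorem failureProb_le (ψ : Joint (Reg nA × Reg nB) H) (hψ : ‖ψ‖ = 1) (x : X) (y : Y) :
    failureProb (aliceOp S e x) (bobOp S e y) (correctionA S) (correctionB S)
      (U x y : Matrix (Reg nA × Reg nB) _ ℂ) ψ ≤ δ := by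
  set s : X × S.K × (Fin nB → Fin 4) → Y × (Fin nB → Fin 4) × S.L → ℝ := fun k l =>
    if k.1 = x then if l.1 = y then (Fintype.card (Reg N) : ℝ)⁻¹ *
      ((Fintype.card (Reg nB) : ℝ)⁻¹ ^ 2 * ‖S.amp x (y, l.2.1) k.2.1 l.2.2‖ ^ 2) else 0 else 0
    with hs
  have hsum : ∑ k, ∑ l, s k l = 1 - δ := by
    have hN : (Fintype.card (Reg N) : ℝ) =
        Fintype.card (Reg nB) * Fintype.card (Reg nB) * Fintype.card (Reg M) := by
      rw [Fintype.card_congr e]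
      simp only [Fintype.card_prod]
      push_cast
      ring
    have hcard : ∀ n : ℕ, (Fintype.card (Reg n) : ℝ) ≠ 0 := fun n =>
      Nat.cast_ne_zero.2 Fintype.card_ne_zero
    have hw : ∑ k, ∑ m, ∑ l, ‖S.amp x (y, m) k l‖ ^ 2 =
        (Fintype.card (Reg nB) : ℝ) ^ 2 * ((1 - δ) * Fintype.card (Reg M)) := by
      rw [Finset.sum_comm]
      simp only [S.weight, Finset.sum_const, Finset.card_univ, nsmul_eq_mul,
        (pauliBasis nB).card_eq]
      push_cast
      ring
    have hcs : Fintype.card (Fin nB → Fin 4) = Fintype.card (Reg nB) ^ 2 := (pauliBasis nB).card_eq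
    simp only [hs, Fintype.sum_prod_type, Finset.sum_ite_irrel, Finset.sum_const_zero,
      Finset.sum_ite_eq', Finset.mem_univ, if_true, ← Finset.mul_sum, Finset.sum_const,
      Finset.card_univ, nsmul_eq_mul, hw, hcs]
    rw [hN]
    push_cast
    have h1 := hcard nB
    have h2 := hcard M
    field_simp
  classical
  have hle : ∀ k l, (if applyOp (U x y : Matrix (Reg nA × Reg nB) _ ℂ) ψ =
      applyOp (correctionA S k l ⊗ₖ correctionB S k l)
        (outputState (aliceOp S e x) (bobOp S e y) ψ k l) then 0
      else outputProb (aliceOp S e x) (bobOp S e y) ψ k l) ≤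
      outputProb (aliceOp S e x) (bobOp S e y) ψ k l - s k l := by
    rintro ⟨x', k, m'⟩ ⟨y', m, l⟩
    by_cases h : x' = x ∧ y' = y ∧ S.amp x (y, m) k l ≠ 0
    · obtain ⟨rfl, rfl, h⟩ := h
      rw [if_pos (applyOp_outputState S e ψ hψ m' h), outputProb_of_amp_ne_zero S e ψ hψ m' h]
      simp [hs]
    · have h0 : s (x', k, m') (y', m, l) = 0 := by
        simp only [hs]
        split_ifs with h1 h2
        · have : S.amp x (y, m) k l = 0 := by
            by_contra h3
            exact h ⟨h1, h2, h3⟩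
          simp [this]
        all_goals rfl
      rw [h0, sub_zero]
      split_ifs
      · exact sq_nonneg _
      · exact le_rfl
  calc _ ≤ ∑ k, ∑ l, (outputProb (aliceOp S e x) (bobOp S e y) ψ k l - s k l) :=
        Finset.sum_le_sum fun k _ => Finset.sum_le_sum fun l _ => hle k l
    _ = δ := by
        simp only [Finset.sum_sub_distrib]
        rw [sum_outputProb, hsum, hψ]
        ring

end Localise

end NonlocalComputation

theorem mainTheorem1 (nA nB : ℕ) {X Y : Type*} [Finite X] [Finite Y]
    (U : X → Y → Matrix.unitaryGroup
      (NonlocalComputation.Reg nA × NonlocalComputation.Reg nB) ℂ)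
    (ε : ℝ) (hε : 0 < ε) :
    ∃ N₀ : ℕ, ∀ N : ℕ, N₀ ≤ N →
      ∃ (K L : Type) (_ : Fintype K) (_ : Fintype L)
        (𝒜 : X → NonlocalComputation.LocalOp nA N K)
        (ℬ : Y → NonlocalComputation.LocalOp nB N L)
        (VA : K → L → Matrix (NonlocalComputation.Reg nA) (NonlocalComputation.Reg nA) ℂ)
        (VB : K → L → Matrix (NonlocalComputation.Reg nB) (NonlocalComputation.Reg nB) ℂ),
        (∀ k l, NonlocalComputation.IsPauliProduct (VA k l)) ∧
        (∀ k l, NonlocalComputation.IsPauliProduct (VB k l)) ∧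
        ∀ (HE : Type*) [NormedAddCommGroup HE] [InnerProductSpace ℂ HE] [CompleteSpace HE]
          (ψ : NonlocalComputation.Joint
            (NonlocalComputation.Reg nA × NonlocalComputation.Reg nB) HE),
          ‖ψ‖ = 1 → ∀ (x : X) (y : Y),
            NonlocalComputation.failureProb (𝒜 x) (ℬ y) VA VB (U x y) ψ ≤ ε := by
  open NonlocalComputation in
  obtain ⟨p, ⟨eX⟩⟩ := Finite.exists_equiv_fin X
  obtain ⟨q, ⟨eY⟩⟩ := Finite.exists_equiv_fin Y
  -- An extra input of Alice makes her set of inputs nonempty.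
  let U' : Option (Fin p) → Fin q → Matrix.unitaryGroup (Reg nA × Reg nB) ℂ :=
    fun i j => i.elim 1 fun i => U (eX.symm i) (eY.symm j)
  set d : ℝ := (Fintype.card (Reg nA × Reg nB) : ℝ) with hd
  have hd1 : 1 ≤ d := Nat.one_le_cast.2 Fintype.card_pos
  have hd2 : 0 < (d ^ 2)⁻¹ ∧ (d ^ 2)⁻¹ ≤ 1 :=
    ⟨by positivity, inv_le_one_of_one_le₀ (one_le_pow₀ hd1)⟩
  obtain ⟨t, ht⟩ := exists_pow_lt_of_lt_one hε (by linarith : 1 - (d ^ 2)⁻¹ < 1)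
  obtain ⟨N₀, hN₀⟩ := exists_scheme ((pauliBasis nA).prod (pauliBasis nB)) (n := nA + nB)
    (by simp [pow_add]) t _ _ (afterTeleport U')
  refine ⟨N₀ + (nB + nB), fun N hN => ?_⟩
  obtain ⟨M, rfl⟩ : ∃ M, N = M + (nB + nB) := ⟨N - (nB + nB), by omega⟩
  obtain ⟨S⟩ := hN₀ M (by omega)
  have e : Reg (M + (nB + nB)) ≃ (Reg nB × Reg nB) × Reg M := by
    refine Fintype.equivOfCardEq ?_
    simp only [Fintype.card_prod, Fintype.card_fun, Fintype.card_fin]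
    rw [← pow_add, ← pow_add, add_comm]
  refine ⟨_, _, inferInstance, inferInstance, fun x => aliceOp S e (some (eX x)),
    fun y => bobOp S e (eY y), correctionA S, correctionB S, isPauliProduct_correctionA S,
    isPauliProduct_correctionB S, fun HE _ _ _ ψ hψ x y => ?_⟩
  have h := failureProb_le S e ψ hψ (some (eX x)) (eY y)
  simp only [U', Option.elim_some, Equiv.symm_apply_apply] at h
  exact h.trans ht.le
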